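/- Let $n,m\ge 1$, let $A\in\mathbb C^{n\times n}$ be skew-Hermitian ($A^*=-A$), let $B\in\mathbb C^{n\times m}$, and let $X$ be a positive semidefinite solution of the algebraic Riccati equation $$XBB^*X-XA-A^*X-I=0,$$ so that $u=-B^*Xx$ is the optimal feedback minimizing $\int_0^\infty (\|x\|^2+\|u\|^2)\,dt$ for $x'=Ax+Bu$ (weights $Q=I$, $R=I$). The closed-loop matrix is $A_{cl}=A-BB^*X$. Let $i\lambda_1,\dots,i\lambda_n$ with $\lambda_1\le\dots\le\lambda_n$ be the eigenvalues of $A$, repeated according to multiplicity, $v_1,\dots,v_n$ an orthonormal basis with $Av_j=i\lambda_jv_j$, and put $b_k=B^*v_k$, $\delta_k=\min_{j\ne k}|\lambda_j-\lambda_k|$ (with $\delta_k=+\infty$ if $n=1$), $\Delta=\max_{j,k}|\lambda_j-\lambda_k|$. Vectors carry the Euclidean norm and matrices the induced norm. Put $$\ell_{est}=\min_{1\le k\le n}\frac{\|b_k\|}{\sqrt2\,\bigl(1+2\|B\|^2/\delta_k^2\bigr)},\qquad \ell_{est}^1=\min_{1\le k\le n}\frac{\|b_k\|}{\sqrt2\,\sqrt{1+2\|B\|^2/\delta_k^2}},$$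 and $\ell_{est}=\ell_{est}^1=0$ if $A$ has a multiple eigenvalue. A box $J\times K$ with $J,K\subset\mathbb R$ means $\{z\in\mathbb C:\operatorname{Re}z\in J,\ \operatorname{Im}z\in K\}$, and eigenvalues are counted with algebraic multiplicity. Then: (1) All eigenvalues of $A_{cl}$ lie in $[-\|B\|,-\ell_{est})\times[\lambda_1,\lambda_n]$. (2) If $m\le n$ and the smallest singular value $\sigma_m$ of $B$ satisfies $\sigma_m>2\sqrt2\,\Delta$, then exactly $m$ eigenvalues of $A_{cl}$ lie in $[-\|B\|,-\tfrac{\sqrt6}{4}\sigma_m]\times[\lambda_1,\lambda_n]$, and the other $n-m$ lie in $(-\sqrt3\,\Delta,-\ell_{est})\times[\lambda_1,\lambda_n]$. (3) If $m=1$, then (1) and (2) hold with $\ell_{est}$ replaced by $\ell_{est}^1$, and $\ell_{est}\le\ell_{est}^1$, with strict inequality if $n\ge2$ and the eigenvalues of $A$ are distinct. -/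

import Mathlib

-- Norms of complex matrices are operator norms induced by the Euclidean norms.
open scoped Matrix Matrix.Norms.L2Operator ComplexOrder

namespace LQR

noncomputable section

variable {n m : ℕ}

/-- `X` is a nonnegative (positive semidefinite) solution of the continuous algebraic Riccati
equation `X B R⁻¹ Bᴴ X - X A - Aᴴ X - Q = 0`. -/
def IsRiccatiSolution (A : Matrix (Fin n) (Fin n) ℂ) (B : Matrix (Fin n) (Fin m) ℂ)
    (Q : Matrix (Fin n) (Fin n) ℂ) (R : Matrix (Fin m) (Fin m) ℂ)
    (X : Matrix (Fin n) (Fin n) ℂ) : Prop :=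
  X.PosSemidef ∧ X * B * R⁻¹ * Bᴴ * X - X * A - Aᴴ * X - Q = 0

/-- The optimal feedback matrix `F = R⁻¹ Bᴴ X`. -/
def feedback (B : Matrix (Fin n) (Fin m) ℂ) (R : Matrix (Fin m) (Fin m) ℂ)
    (X : Matrix (Fin n) (Fin n) ℂ) : Matrix (Fin m) (Fin n) ℂ :=
  R⁻¹ * Bᴴ * X

/-- The matrix `A - B F` of the closed-loop system. -/
def closedLoop (A : Matrix (Fin n) (Fin n) ℂ) (B : Matrix (Fin n) (Fin m) ℂ)
    (R : Matrix (Fin m) (Fin m) ℂ) (X : Matrix (Fin n) (Fin n) ℂ) : Matrix (Fin n) (Fin n) ℂ :=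
  A - B * feedback B R X

/-- The number of eigenvalues of `M` in `S`, counted with algebraic multiplicity. -/
def eigCount (M : Matrix (Fin n) (Fin n) ℂ) (S : Set ℂ) : ℕ := by
  classical exact M.charpoly.roots.countP (fun z => z ∈ S)

/-- The vector `b_k = Bᴴ v_k`. -/
def bVec (B : Matrix (Fin n) (Fin m) ℂ)
    (v : OrthonormalBasis (Fin n) ℂ (EuclideanSpace ℂ (Fin n))) (k : Fin n) :
    EuclideanSpace ℂ (Fin m) :=
  Matrix.toEuclideanLin Bᴴ (v k)

/-- The separation `δ_k = min_{j ≠ k} |λ_j - λ_k|`. If `n = 1` the index set is empty and the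
value is `0` instead of the conventional `+∞`; since `x / 0 = 0`, the quotient `‖B‖ ^ 2 / δ_k ^ 2`
used below is then `0` in both readings. -/
def sep (lam : Fin n → ℝ) (k : Fin n) : ℝ :=
  ⨅ j : {j : Fin n // j ≠ k}, |lam j - lam k|

/-- The diameter `Δ = max_{j,k} |λ_j - λ_k|`. -/
def diam (lam : Fin n → ℝ) : ℝ :=
  ⨆ p : Fin n × Fin n, |lam p.1 - lam p.2|

open Classical in
/-- The bound `ℓ_est`; it is put equal to `0` if there are multiple eigenvalues. -/
def ellEst (B : Matrix (Fin n) (Fin m) ℂ) (lam : Fin n → ℝ)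
    (v : OrthonormalBasis (Fin n) ℂ (EuclideanSpace ℂ (Fin n))) : ℝ :=
  if Function.Injective lam then
    ⨅ k : Fin n, ‖bVec B v k‖ / (√2 * (1 + 2 * (‖B‖ ^ 2 / sep lam k ^ 2)))
  else 0

open Classical in
/-- The bound `ℓ_est^1`; it is put equal to `0` if there are multiple eigenvalues. -/
def ellEstOne (B : Matrix (Fin n) (Fin m) ℂ) (lam : Fin n → ℝ)
    (v : OrthonormalBasis (Fin n) ℂ (EuclideanSpace ℂ (Fin n))) : ℝ :=
  if Function.Injective lam then
    ⨅ k : Fin n, ‖bVec B v k‖ / (√2 * √(1 + 2 * (‖B‖ ^ 2 / sep lam k ^ 2)))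
  else 0

/-- The smallest singular value `σ_m` of an `n × m` matrix (`m ≥ 1`). Mathlib numbers the
singular values `σ_1 ≥ … ≥ σ_m` from `0`. -/
def sigmaMin (B : Matrix (Fin n) (Fin m) ℂ) : ℝ :=
  (Matrix.toEuclideanLin B).singularValues (m - 1)

end

end LQR

/-! Let w be a closed-loop eigenvector for ν = -s + iω, and put y = Xw. The Riccati equation reads X
A_cl = AX - 1, so (A - ν)y = w and (A - ν)²y = BBᴴy, from which X has disappeared. In the eigenbasis
of A, with d_j = λ_j - ω, this is the system `ModalSolution`. Pairing it with u = Bᴴy gives two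
identities: the imaginary part makes ω a weighted mean of the λ_j, and the real part is ‖u‖² = Σ (s²
- d_j²)|c_j|².

Comparing the latter with Σ |⟨b_j,u⟩|² = ‖Bu‖² yields s ≤ ‖B‖ (`le_bound`), and also a gap: s ≥ √3 Δ
forces s ≥ (√6/4) σ_m (`gap`). Moreover some mode has |d_k| < s. Separation of the frequencies makes
the other modes contribute little to u, so ‖b_k‖ is controlled by s (`norm_lt`,
`norm_lt_of_norm_inner_eq`).

To count the fast eigenvalues, A is deformed to a scalar matrix. A Riccati solution need not survive
this, so the path runs through Hamiltonian matrices, whose left half-plane eigenvalues obey the same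
modal system and hence the same gap. No eigenvalue crosses a line inside the gap
(`countP_roots_charpoly_eq_of_path`). At the scalar end the spectrum is explicit, and at the other
end the Hamiltonian polynomial splits into the closed-loop one and its reflection
(`charpoly_hamiltonian`). -/

namespace LQR

/-! ### Modal equations and the resulting bounds on decay rates. -/

section ModalEquations

variable {ι F : Type*} [NormedAddCommGroup F] [InnerProductSpace ℂ F]

/-- The modal form of the quadratic eigenvalue problem `(A - ν)² y = B Bᴴ y`, for
`ν = -s + i ω`, `d j = λ j - ω`, `b j = Bᴴ v j`, `u = Bᴴ y` and `c` the coordinates of `y`. -/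
structure ModalSolution [Fintype ι] (b : ι → F) (s : ℝ) (d : ι → ℝ) (c : ι → ℂ) (u : F) :
    Prop where
  pos : 0 < s
  ne_zero : c ≠ 0
  sum_eq : u = ∑ j, c j • b j
  inner_eq : ∀ j, inner ℂ (b j) u = ((s : ℂ) + Complex.I * d j) ^ 2 * c j

variable [Fintype ι] {b : ι → F} {s : ℝ} {d : ι → ℝ} {c : ι → ℂ} {u : F}

lemma norm_sq_add_I_mul (s t : ℝ) : ‖((s : ℂ) + Complex.I * t) ^ 2‖ = s ^ 2 + t ^ 2 := by
  rw [norm_pow, ← Complex.normSq_eq_norm_sq, Complex.normSq_apply]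
  simp; ring

namespace ModalSolution

lemma norm_inner (h : ModalSolution b s d c u) (j : ι) :
    ‖inner ℂ (b j) u‖ = (s ^ 2 + d j ^ 2) * ‖c j‖ := by
  rw [h.inner_eq, norm_mul, norm_sq_add_I_mul]

lemma inner_partial_sum (h : ModalSolution b s d c u) (S : Finset ι) :
    inner ℂ u (∑ j ∈ S, c j • b j) =
      ∑ j ∈ S, ((s : ℂ) - Complex.I * d j) ^ 2 * ((‖c j‖ ^ 2 : ℝ) : ℂ) := by
  rw [inner_sum]
  refine Finset.sum_congr rfl fun j _ => ?_
  rw [inner_smul_right, ← inner_conj_symm, h.inner_eq, ← Complex.normSq_eq_norm_sq,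
    Complex.normSq_eq_conj_mul_self]
  simp only [map_mul, map_pow, map_add, Complex.conj_ofReal, Complex.conj_I]
  ring

lemma re_inner_partial_sum (h : ModalSolution b s d c u) (S : Finset ι) :
    (inner ℂ u (∑ j ∈ S, c j • b j)).re = ∑ j ∈ S, (s ^ 2 - d j ^ 2) * ‖c j‖ ^ 2 := by
  rw [h.inner_partial_sum, Complex.re_sum]
  refine Finset.sum_congr rfl fun j _ => ?_
  rw [Complex.re_mul_ofReal]
  congr 1
  simp [sq]

lemma norm_sq_eq (h : ModalSolution b s d c u) :
    ‖u‖ ^ 2 = ∑ j, (s ^ 2 - d j ^ 2) * ‖c j‖ ^ 2 := by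
  have h1 := h.re_inner_partial_sum Finset.univ
  rw [← h.sum_eq] at h1
  rw [← h1, inner_self_eq_norm_sq_to_K]
  norm_cast

lemma sum_mul_norm_sq_eq_zero (h : ModalSolution b s d c u) : ∑ j, d j * ‖c j‖ ^ 2 = 0 := by
  have h1 := h.inner_partial_sum Finset.univ
  rw [← h.sum_eq, inner_self_eq_norm_sq_to_K] at h1
  have h2 := congrArg Complex.im h1
  rw [Complex.im_sum] at h2
  have h3 : ∀ j, (((s : ℂ) - Complex.I * d j) ^ 2 * ((‖c j‖ ^ 2 : ℝ) : ℂ)).im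
      = (-2 * s) * (d j * ‖c j‖ ^ 2) := by
    intro j
    rw [Complex.im_mul_ofReal, ← mul_assoc]
    congr 1
    simp [sq]; ring
  simp only [h3, ← Finset.mul_sum] at h2
  have h4 : (((‖u‖ : ℝ) : ℂ) ^ 2).im = 0 := by norm_cast
  have h5 := h.pos
  have h6 : (-2 * s) * ∑ j, d j * ‖c j‖ ^ 2 = 0 := h2.symm.trans h4
  rcases mul_eq_zero.mp h6 with h7 | h7
  · linarith
  · exact h7

lemma sum_norm_sq_pos (h : ModalSolution b s d c u) : 0 < ∑ j, ‖c j‖ ^ 2 := by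
  obtain ⟨j, hj⟩ := Function.ne_iff.mp h.ne_zero
  have : c j ≠ 0 := hj
  exact Finset.sum_pos' (fun _ _ => by positivity) ⟨j, Finset.mem_univ _, by positivity⟩

lemma vector_ne_zero (h : ModalSolution b s d c u) : u ≠ 0 := by
  rintro rfl
  apply h.ne_zero
  funext j
  have h1 := h.norm_inner j
  have h2 : s ^ 2 + d j ^ 2 ≠ 0 := by have := h.pos; positivity
  simpa [h2] using h1

/-- The frequency `ω` is a weighted mean of the `λ j`. -/
lemma mean_mem_Icc {lam : ι → ℝ} {ω p q : ℝ}
    (h : ModalSolution b s (fun j => lam j - ω) c u) (hlam : ∀ j, lam j ∈ Set.Icc p q) :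
    ω ∈ Set.Icc p q := by
  have h1 := h.sum_mul_norm_sq_eq_zero
  have h2 := h.sum_norm_sq_pos
  simp only [sub_mul, Finset.sum_sub_distrib, ← Finset.mul_sum] at h1
  have h3 : p * ∑ j, ‖c j‖ ^ 2 ≤ ∑ j, lam j * ‖c j‖ ^ 2 := by
    rw [Finset.mul_sum]
    exact Finset.sum_le_sum fun j _ => mul_le_mul_of_nonneg_right (hlam j).1 (by positivity)
  have h4 : ∑ j, lam j * ‖c j‖ ^ 2 ≤ q * ∑ j, ‖c j‖ ^ 2 := by
    rw [Finset.mul_sum]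
    exact Finset.sum_le_sum fun j _ => mul_le_mul_of_nonneg_right (hlam j).2 (by positivity)
  constructor
  · refine le_of_mul_le_mul_right ?_ h2; linarith
  · refine le_of_mul_le_mul_right ?_ h2; linarith

/-- Otherwise no term of ‖u‖² = Σ (s² - d_j²)|c_j|² would be positive, although u ≠ 0. -/
lemma exists_abs_lt (h : ModalSolution b s d c u) : ∃ k, |d k| < s := by
  by_contra! hd
  have h1 := h.norm_sq_eq
  have h2 : ∑ j, (s ^ 2 - d j ^ 2) * ‖c j‖ ^ 2 ≤ 0 := by
    refine Finset.sum_nonpos fun j _ => mul_nonpos_of_nonpos_of_nonneg ?_ (by positivity)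
    have := sq_le_sq' (by linarith [h.pos, hd j]) (hd j)
    rw [sq_abs] at this
    linarith
  have h3 := norm_pos_iff.mpr h.vector_ne_zero
  nlinarith

variable {β : ℝ}

/-- s⁴ Σ|c_j|² ≤ Σ|⟨b_j,u⟩|² ≤ β²‖u‖² ≤ β² s² Σ|c_j|². -/
lemma le_bound (h : ModalSolution b s d c u) (hβ0 : 0 ≤ β)
    (hβ : ∀ w : F, ∑ j, ‖inner ℂ (b j) w‖ ^ 2 ≤ β ^ 2 * ‖w‖ ^ 2) : s ≤ β := by
  have h1 := hβ u
  rw [h.norm_sq_eq] at h1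
  have h2 := h.sum_norm_sq_pos
  have h3 : s ^ 4 * ∑ j, ‖c j‖ ^ 2 ≤ ∑ j, ‖inner ℂ (b j) u‖ ^ 2 := by
    rw [Finset.mul_sum]
    refine Finset.sum_le_sum fun j _ => ?_
    rw [h.norm_inner, mul_pow]
    refine mul_le_mul_of_nonneg_right ?_ (by positivity)
    nlinarith [sq_nonneg (d j), sq_nonneg s, mul_nonneg (sq_nonneg s) (sq_nonneg (d j))]
  have h4 : ∑ j, (s ^ 2 - d j ^ 2) * ‖c j‖ ^ 2 ≤ s ^ 2 * ∑ j, ‖c j‖ ^ 2 := by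
    rw [Finset.mul_sum]
    refine Finset.sum_le_sum fun j _ => mul_le_mul_of_nonneg_right ?_ (by positivity)
    nlinarith [sq_nonneg (d j)]
  have hs := h.pos
  have h5 : s ^ 2 * (s ^ 2 * ∑ j, ‖c j‖ ^ 2) ≤ β ^ 2 * (s ^ 2 * ∑ j, ‖c j‖ ^ 2) := by
    have := mul_le_mul_of_nonneg_left h4 (sq_nonneg β)
    nlinarith
  exact le_of_sq_le_sq (le_of_mul_le_mul_right h5 (by positivity)) hβ0

end ModalSolution

/-- The synthesis operator of a Bessel family obeys the same bound as the analysis operator. -/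
lemma norm_sum_smul_le_of_bessel {β : ℝ} (hβ0 : 0 ≤ β)
    (hβ : ∀ w : F, ∑ j, ‖inner ℂ (b j) w‖ ^ 2 ≤ β ^ 2 * ‖w‖ ^ 2) (S : Finset ι) (c : ι → ℂ) :
    ‖∑ j ∈ S, c j • b j‖ ≤ β * √(∑ j ∈ S, ‖c j‖ ^ 2) := by
  set w := ∑ j ∈ S, c j • b j with hw
  rcases (norm_nonneg w).eq_or_lt with h0 | h0
  · rw [← h0]; positivity
  have h1 : ‖w‖ ^ 2 ≤ ∑ j ∈ S, ‖c j‖ * ‖inner ℂ (b j) w‖ := by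
    calc ‖w‖ ^ 2 = ‖inner ℂ w w‖ := by rw [inner_self_eq_norm_sq_to_K]; simp
      _ = ‖∑ j ∈ S, c j * inner ℂ w (b j)‖ := by
        conv_lhs => rw [hw, inner_sum, ← hw]
        simp only [inner_smul_right]
      _ ≤ ∑ j ∈ S, ‖c j‖ * ‖inner ℂ (b j) w‖ := by
        refine (norm_sum_le _ _).trans (Finset.sum_le_sum fun j _ => ?_)
        rw [norm_mul, norm_inner_symm]
  have h2 : ∑ j ∈ S, ‖c j‖ * ‖inner ℂ (b j) w‖ ≤
      √(∑ j ∈ S, ‖c j‖ ^ 2) * √(∑ j ∈ S, ‖inner ℂ (b j) w‖ ^ 2) :=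
    Real.sum_mul_le_sqrt_mul_sqrt _ _ _
  have h3 : √(∑ j ∈ S, ‖inner ℂ (b j) w‖ ^ 2) ≤ β * ‖w‖ := by
    refine Real.sqrt_le_iff.mpr ⟨by positivity, ?_⟩
    rw [mul_pow]
    exact (Finset.sum_le_sum_of_subset_of_nonneg (Finset.subset_univ S)
      fun _ _ _ => by positivity).trans (hβ w)
  have h4 := mul_le_mul_of_nonneg_left h3 (Real.sqrt_nonneg (∑ j ∈ S, ‖c j‖ ^ 2))
  refine le_of_mul_le_mul_right ?_ h0
  nlinarith

lemma norm_le_of_bessel {β : ℝ} (hβ0 : 0 ≤ β)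
    (hβ : ∀ w : F, ∑ j, ‖inner ℂ (b j) w‖ ^ 2 ≤ β ^ 2 * ‖w‖ ^ 2) (k : ι) : ‖b k‖ ≤ β := by
  classical
  simpa using norm_sum_smul_le_of_bessel hβ0 hβ {k} (fun _ => 1)

namespace ModalSolution

variable {β : ℝ}

open Classical in
-- For j ≠ k, δ ≤ |d_j| + s, hence s² + d_j² ≥ δ²/2 and |c_j| ≤ (2/δ²)|⟨b_j,u⟩|. The Bessel bound
-- enters twice, for the coefficients and for their synthesis. The form of `hsep` admits δ = 0
-- exactly when k is the only index.
lemma norm_sum_erase_le (h : ModalSolution b s d c u) (hβ0 : 0 ≤ β)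
    (hβ : ∀ w : F, ∑ j, ‖inner ℂ (b j) w‖ ^ 2 ≤ β ^ 2 * ‖w‖ ^ 2) {k : ι} {δ : ℝ}
    (hk : |d k| < s) (hδ : 0 ≤ δ) (hsep : ∀ j, j ≠ k → 0 < δ ∧ δ ≤ |d j - d k|) :
    ‖∑ j ∈ Finset.univ.erase k, c j • b j‖ ≤ 2 * (β ^ 2 / δ ^ 2) * ‖u‖ := by
  rcases hδ.eq_or_lt with rfl | hδ0
  · have h1 : (Finset.univ.erase k : Finset ι) = ∅ := by
      rw [Finset.eq_empty_iff_forall_notMem]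
      intro j hj
      exact absurd (hsep j (Finset.ne_of_mem_erase hj)).1 (lt_irrefl _)
    rw [h1]; simp
  have h1 : ∀ j ∈ Finset.univ.erase k, δ ^ 2 / 2 * ‖c j‖ ≤ ‖inner ℂ (b j) u‖ := by
    intro j hj
    rw [h.norm_inner]
    refine mul_le_mul_of_nonneg_right ?_ (norm_nonneg _)
    have h2 := (hsep j (Finset.ne_of_mem_erase hj)).2
    have h3 : δ ≤ |d j| + s := by linarith [abs_sub (d j) (d k)]
    have h4 : δ ^ 2 ≤ (|d j| + s) ^ 2 := pow_le_pow_left₀ hδ h3 2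
    have h5 := sq_abs (d j)
    nlinarith [sq_nonneg (|d j| - s)]
  have h2 : √(∑ j ∈ Finset.univ.erase k, ‖c j‖ ^ 2) ≤ 2 / δ ^ 2 * (β * ‖u‖) := by
    refine Real.sqrt_le_iff.mpr ⟨by positivity, ?_⟩
    have h3 : ∑ j ∈ Finset.univ.erase k, ‖c j‖ ^ 2 ≤
        (2 / δ ^ 2) ^ 2 * ∑ j ∈ Finset.univ.erase k, ‖inner ℂ (b j) u‖ ^ 2 := by
      rw [Finset.mul_sum]
      refine Finset.sum_le_sum fun j hj => ?_
      rw [← mul_pow]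
      refine pow_le_pow_left₀ (norm_nonneg _) ?_ 2
      have h4 := h1 j hj
      rw [div_mul_eq_mul_div, le_div_iff₀ (by positivity)]
      linarith
    have h5 : ∑ j ∈ Finset.univ.erase k, ‖inner ℂ (b j) u‖ ^ 2 ≤ β ^ 2 * ‖u‖ ^ 2 :=
      (Finset.sum_le_sum_of_subset_of_nonneg (Finset.subset_univ _)
        fun _ _ _ => by positivity).trans (hβ u)
    rw [mul_pow, mul_pow]
    exact h3.trans (mul_le_mul_of_nonneg_left h5 (by positivity))
  calc _ ≤ β * √(∑ j ∈ Finset.univ.erase k, ‖c j‖ ^ 2) := norm_sum_smul_le_of_bessel hβ0 hβ _ _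
    _ ≤ β * (2 / δ ^ 2 * (β * ‖u‖)) := mul_le_mul_of_nonneg_left h2 hβ0
    _ = _ := by ring

open Classical in
lemma smul_eq_sub (h : ModalSolution b s d c u) (k : ι) :
    c k • b k = u - ∑ j ∈ Finset.univ.erase k, c j • b j := by
  rw [eq_sub_iff_add_eq, Finset.add_sum_erase _ (fun j => c j • b j) (Finset.mem_univ k)]
  exact h.sum_eq.symm

lemma norm_mul_norm_le (h : ModalSolution b s d c u) (hβ0 : 0 ≤ β)
    (hβ : ∀ w : F, ∑ j, ‖inner ℂ (b j) w‖ ^ 2 ≤ β ^ 2 * ‖w‖ ^ 2) {k : ι} {δ : ℝ}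
    (hk : |d k| < s) (hδ : 0 ≤ δ) (hsep : ∀ j, j ≠ k → 0 < δ ∧ δ ≤ |d j - d k|) :
    ‖c k‖ * ‖b k‖ ≤ (1 + 2 * (β ^ 2 / δ ^ 2)) * ‖u‖ := by
  classical
  have h1 := h.norm_sum_erase_le hβ0 hβ hk hδ hsep
  rw [← norm_smul, h.smul_eq_sub]
  refine (norm_sub_le _ _).trans ?_
  linarith

/-- Lower bound for the decay rate in terms of a mode `k` with `|λ k - ω| < s`. -/
lemma norm_lt (h : ModalSolution b s d c u) (hβ0 : 0 ≤ β)
    (hβ : ∀ w : F, ∑ j, ‖inner ℂ (b j) w‖ ^ 2 ≤ β ^ 2 * ‖w‖ ^ 2) {k : ι} {δ : ℝ}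
    (hk : |d k| < s) (hδ : 0 ≤ δ) (hsep : ∀ j, j ≠ k → 0 < δ ∧ δ ≤ |d j - d k|) :
    ‖b k‖ < √2 * (1 + 2 * (β ^ 2 / δ ^ 2)) * s := by
  classical
  have hs := h.pos
  have hsqrt2 : (1 : ℝ) < √2 := by
    rw [Real.lt_sqrt (by norm_num)]; norm_num
  -- If k is the only mode with |d_k| < s, the norm identity gives ‖u‖ ≤ s|c_k|. With a second such
  -- mode, δ < 2s and the crude bound ‖b_k‖ ≤ β suffices.
  by_cases hfar : ∀ j, j ≠ k → s ≤ |d j|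
  · have h1 := h.norm_mul_norm_le hβ0 hβ hk hδ hsep
    have h2 := h.norm_sq_eq
    rw [← Finset.add_sum_erase _ _ (Finset.mem_univ k)] at h2
    have h3 : ∑ j ∈ Finset.univ.erase k, (s ^ 2 - d j ^ 2) * ‖c j‖ ^ 2 ≤ 0 := by
      refine Finset.sum_nonpos fun j hj => mul_nonpos_of_nonpos_of_nonneg ?_ (by positivity)
      have := pow_le_pow_left₀ hs.le (hfar j (Finset.ne_of_mem_erase hj)) 2
      rw [sq_abs] at this
      linarith
    have h4 : ‖u‖ ^ 2 ≤ (s * ‖c k‖) ^ 2 := by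
      have := mul_nonneg (sq_nonneg (d k)) (sq_nonneg ‖c k‖)
      nlinarith
    have h5 : ‖u‖ ≤ s * ‖c k‖ := le_of_sq_le_sq h4 (by positivity)
    have hu := norm_pos_iff.mpr h.vector_ne_zero
    have hc : 0 < ‖c k‖ := pos_of_mul_pos_right (hu.trans_le h5) hs.le
    have h6 : ‖b k‖ ≤ (1 + 2 * (β ^ 2 / δ ^ 2)) * s := by
      refine le_of_mul_le_mul_left ?_ hc
      refine h1.trans ?_
      have := mul_le_mul_of_nonneg_left h5 (a := 1 + 2 * (β ^ 2 / δ ^ 2)) (by positivity)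
      linarith
    refine h6.trans_lt ?_
    have h7 : 0 < (1 + 2 * (β ^ 2 / δ ^ 2)) * s := by positivity
    rw [mul_assoc]
    nlinarith
  · push Not at hfar
    obtain ⟨j, hj, hjs⟩ := hfar
    obtain ⟨hδ0, hδle⟩ := hsep j hj
    have h1 : δ < 2 * s := by linarith [abs_sub (d j) (d k)]
    have hβpos : 0 < β := hs.trans_le (h.le_bound hβ0 hβ)
    refine (norm_le_of_bessel hβ0 hβ k).trans_lt ?_
    set r := β / δ with hr
    have hr0 : 0 < r := by positivity
    have h2 : β ^ 2 / δ ^ 2 = r ^ 2 := by rw [hr, div_pow]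
    have h3 : 2 * r < √2 * (1 + 2 * r ^ 2) * 1 := by
      have h4 : √2 ^ 2 = 2 := Real.sq_sqrt (by norm_num)
      -- Completing the square gives √2(1 + 2r²) ≥ 4r, stronger than needed.
      have h5 : 0 ≤ √2 * (1 - √2 * r) ^ 2 := by positivity
      have h6 : √2 * (1 - √2 * r) ^ 2 = √2 * (1 + √2 ^ 2 * r ^ 2) - 2 * √2 ^ 2 * r := by ring
      rw [h6, h4] at h5
      linarith
    have h4 : β = r * δ := by rw [hr]; field_simp
    rw [h2]
    calc β = r * δ := h4
      _ < r * (2 * s) := mul_lt_mul_of_pos_left h1 hr0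
      _ = (2 * r) * s := by ring
      _ < _ := by
        have := mul_lt_mul_of_pos_right h3 hs
        linarith

/-- The sharper lower bound in the single-input case, where `|⟪b k, u⟫| = ‖b k‖ ‖u‖`. -/
lemma norm_lt_of_norm_inner_eq (h : ModalSolution b s d c u) (hβ0 : 0 ≤ β)
    (hβ : ∀ w : F, ∑ j, ‖inner ℂ (b j) w‖ ^ 2 ≤ β ^ 2 * ‖w‖ ^ 2) {k : ι} {δ : ℝ}
    (hk : |d k| < s) (hδ : 0 ≤ δ) (hsep : ∀ j, j ≠ k → 0 < δ ∧ δ ≤ |d j - d k|)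
    (hb : ‖inner ℂ (b k) u‖ = ‖b k‖ * ‖u‖) :
    ‖b k‖ < √2 * √(1 + 2 * (β ^ 2 / δ ^ 2)) * s := by
  have hs := h.pos
  have h1 := h.norm_mul_norm_le hβ0 hβ hk hδ hsep
  rw [h.norm_inner] at hb
  have hu := norm_pos_iff.mpr h.vector_ne_zero
  set a := 1 + 2 * (β ^ 2 / δ ^ 2) with ha
  have ha0 : 0 < a := by positivity
  have h2 : d k ^ 2 < s ^ 2 := by
    rw [← sq_abs (d k)]
    exact pow_lt_pow_left₀ hk (abs_nonneg _) two_ne_zero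
  -- Equality in Cauchy–Schwarz lets the modal equation be used for ‖b_k‖², so the factor a appears
  -- under a square root; d_k² < s² then supplies the √2.
  have h3 : ‖b k‖ ^ 2 * ‖u‖ ≤ ((s ^ 2 + d k ^ 2) * a) * ‖u‖ := by
    calc ‖b k‖ ^ 2 * ‖u‖ = ‖b k‖ * (‖b k‖ * ‖u‖) := by ring
      _ = (s ^ 2 + d k ^ 2) * (‖c k‖ * ‖b k‖) := by rw [← hb]; ring
      _ ≤ (s ^ 2 + d k ^ 2) * (a * ‖u‖) := mul_le_mul_of_nonneg_left h1 (by positivity)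
      _ = _ := by ring
  have h4 := le_of_mul_le_mul_right h3 hu
  refine lt_of_pow_lt_pow_left₀ 2 (by positivity) ?_
  rw [mul_pow, mul_pow, Real.sq_sqrt (by norm_num), Real.sq_sqrt ha0.le]
  nlinarith

/-- There is a gap in the possible decay rates if the frequencies are concentrated. -/
lemma gap (h : ModalSolution b s d c u) {σ D : ℝ}
    (hB : σ ^ 2 * ‖u‖ ^ 2 ≤ ∑ j, ‖inner ℂ (b j) u‖ ^ 2) (hD : ∀ j, |d j| ≤ D)
    (hsD : √3 * D ≤ s) : √6 / 4 * σ ≤ s := by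
  have hs := h.pos
  have hd : ∀ j, 3 * d j ^ 2 ≤ s ^ 2 := by
    intro j
    have h1 : √3 * |d j| ≤ s := (mul_le_mul_of_nonneg_left (hD j) (by positivity)).trans hsD
    have h2 := pow_le_pow_left₀ (by positivity) h1 2
    rwa [mul_pow, sq_abs, Real.sq_sqrt (by norm_num)] at h2
  have h1 : 3 * ∑ j, ‖inner ℂ (b j) u‖ ^ 2 ≤ 8 * s ^ 2 * ‖u‖ ^ 2 := by
    rw [h.norm_sq_eq, Finset.mul_sum, Finset.mul_sum]
    refine Finset.sum_le_sum fun j _ => ?_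
    rw [h.norm_inner, mul_pow, ← mul_assoc, ← mul_assoc]
    refine mul_le_mul_of_nonneg_right ?_ (by positivity)
    -- 8s²(s² - d²) - 3(s² + d²)² = (s² - 3d²)(5s² + d²), which is where √3 and √6/4 = √(3/8) come
    -- from.
    nlinarith [hd j, sq_nonneg (d j), mul_nonneg (sub_nonneg.mpr (hd j)) (sq_nonneg s),
      mul_nonneg (sub_nonneg.mpr (hd j)) (sq_nonneg (d j))]
  have hu := norm_pos_iff.mpr h.vector_ne_zero
  have h2 : 3 * σ ^ 2 ≤ 8 * s ^ 2 := by
    refine le_of_mul_le_mul_right ?_ (pow_pos hu 2)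
    linarith
  refine le_of_sq_le_sq ?_ hs.le
  have h6 : √6 ^ 2 = 6 := Real.sq_sqrt (by norm_num)
  rw [mul_pow, div_pow, h6]
  linarith

end ModalSolution

end ModalEquations

/-! ### Continuity of eigenvalue counts along a path. -/

section RootCounting

open Polynomial Filter Topology

variable {ι : Type*} [Fintype ι] [DecidableEq ι]

/-- Indexing the roots by ι makes them a point of ℂ^ι, to which compactness applies. -/
lemma exists_charpoly_eq_prod (M : Matrix ι ι ℂ) :
    ∃ r : ι → ℂ, M.charpoly = ∏ i, (X - C (r i)) := by
  have h1 : M.charpoly.roots.card = Fintype.card ι := by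
    rw [IsAlgClosed.card_roots_eq_natDegree, Matrix.charpoly_natDegree_eq_dim]
  obtain ⟨e⟩ : Nonempty (ι ≃ Fin M.charpoly.roots.toList.length) :=
    ⟨Fintype.equivOfCardEq (by simp [h1])⟩
  refine ⟨fun i => M.charpoly.roots.toList.get (e i), ?_⟩
  rw [Equiv.prod_comp e (fun k => X - C (M.charpoly.roots.toList.get k))]
  have h2 := (IsAlgClosed.splits M.charpoly).eq_prod_roots_of_monic M.charpoly_monic
  conv_lhs => rw [h2, ← Multiset.coe_toList M.charpoly.roots]
  rw [Multiset.map_coe, Multiset.prod_coe, ← List.prod_ofFn]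
  congr 1
  conv_lhs => rw [← List.ofFn_get M.charpoly.roots.toList, List.map_ofFn]
  rfl

lemma roots_charpoly_of_eq_prod {M : Matrix ι ι ℂ} {r : ι → ℂ}
    (h : M.charpoly = ∏ i, (X - C (r i))) : M.charpoly.roots = Finset.univ.val.map r := by
  rw [h, Polynomial.roots_prod _ _ (Finset.prod_ne_zero_iff.mpr fun i _ => X_sub_C_ne_zero _)]
  simp [Polynomial.roots_X_sub_C, Multiset.bind_singleton]

lemma mem_spectrum_iff_mem_roots_charpoly {M : Matrix ι ι ℂ} {z : ℂ} :
    z ∈ spectrum ℂ M ↔ z ∈ M.charpoly.roots := by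
  rw [Matrix.mem_spectrum_iff_isRoot_charpoly, mem_roots M.charpoly_monic.ne_zero]

open Classical in
/-- The number of eigenvalues to the left of a vertical line is constant along a path of matrices
which have no eigenvalue on the line. -/
theorem countP_roots_charpoly_eq_of_path (M : unitInterval → Matrix ι ι ℂ) (hM : Continuous M)
    (γ : ℝ) (hγ : ∀ t, ∀ z ∈ spectrum ℂ (M t), z.re ≠ γ) (t₀ t₁ : unitInterval) :
    (M t₀).charpoly.roots.countP (fun z => z.re < γ) =
      (M t₁).charpoly.roots.countP (fun z => z.re < γ) := by
  set f : unitInterval → ℕ := fun t => (M t).charpoly.roots.countP (fun z => z.re < γ) with hf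
  suffices hcont : Continuous f from
    PreconnectedSpace.constant inferInstance hcont
  choose r hr using fun t => exists_charpoly_eq_prod (M t)
  have hroots := fun t => roots_charpoly_of_eq_prod (hr t)
  have hmem : ∀ t i, r t i ∈ spectrum ℂ (M t) := by
    intro t i
    rw [mem_spectrum_iff_mem_roots_charpoly, hroots]
    exact Multiset.mem_map_of_mem (r t) (Finset.mem_univ_val i)
  obtain ⟨R, hR⟩ : ∃ R, ∀ t, ‖M t‖ ≤ R := by
    obtain ⟨R, hR⟩ := (isCompact_range hM).isBounded.exists_norm_le
    exact ⟨R, fun t => hR _ ⟨t, rfl⟩⟩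
  have hcount : ∀ t, f t = (Finset.univ.filter fun i => (r t i).re < γ).card := by
    intro t
    simp only [hf, hroots, Multiset.countP_map]
    rfl
  -- ℕ is discrete, so the preimage of an arbitrary set has to be closed; this is checked on
  -- sequences, by extracting a convergent subsequence of root tuples.
  refine continuous_iff_isClosed.mpr fun S _ => ?_
  refine IsSeqClosed.isClosed fun t a ht hta => ?_
  have hbdd : ∀ k, r (t k) ∈ Metric.closedBall (0 : ι → ℂ) R := by
    intro k
    rw [mem_closedBall_zero_iff]
    have hR0 : 0 ≤ R := (norm_nonneg _).trans (hR a)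
    refine (pi_norm_le_iff_of_nonneg hR0).mpr fun i => ?_
    have : Nonempty ι := ⟨i⟩
    exact (spectrum.norm_le_norm_of_mem (hmem _ i)).trans (hR _)
  obtain ⟨q, -, φ, hφ, hq⟩ := tendsto_subseq_of_bounded Metric.isBounded_closedBall hbdd
  have hq' : ∀ i, Tendsto (fun k => r (t (φ k)) i) atTop (𝓝 (q i)) :=
    fun i => ((continuous_apply i).tendsto q).comp hq
  have htφ : Tendsto (fun k => t (φ k)) atTop (𝓝 a) := hta.comp hφ.tendsto_atTop
  -- The limit tuple consists of the roots at `a`, since both sides are limits of the same values at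
  -- each z.
  have hqa : (M a).charpoly = ∏ i, (X - C (q i)) := by
    refine Polynomial.funext fun z => ?_
    have h1 : Tendsto (fun k => (M (t (φ k))).charpoly.eval z) atTop
        (𝓝 ((M a).charpoly.eval z)) := by
      simp only [Matrix.eval_charpoly]
      exact ((Continuous.matrix_det (continuous_const.sub hM)).tendsto a).comp htφ
    refine tendsto_nhds_unique h1 ?_
    simp only [hr, eval_prod, eval_sub, eval_X, eval_C]
    exact tendsto_finsetProd _ fun i _ => (hq' i).const_sub z
  have hqroots := roots_charpoly_of_eq_prod hqa
  have hqne : ∀ i, (q i).re ≠ γ := by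
    intro i
    refine hγ a _ ?_
    rw [mem_spectrum_iff_mem_roots_charpoly, hqroots]
    exact Multiset.mem_map_of_mem q (Finset.mem_univ_val i)
  have hev : ∀ i, ∀ᶠ k in atTop, ((r (t (φ k)) i).re < γ ↔ (q i).re < γ) := by
    intro i
    have hre : Tendsto (fun k => (r (t (φ k)) i).re) atTop (𝓝 (q i).re) :=
      (Complex.continuous_re.tendsto _).comp (hq' i)
    rcases (hqne i).lt_or_gt with h | h
    · filter_upwards [hre.eventually (gt_mem_nhds h)] with k hk
      exact iff_of_true hk h
    · filter_upwards [hre.eventually (lt_mem_nhds h)] with k hk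
      exact iff_of_false hk.not_gt h.not_gt
  obtain ⟨k, hk⟩ := (eventually_all.mpr hev).exists
  have hfa : f a = f (t (φ k)) := by
    rw [hcount (t (φ k))]
    simp only [hf, hqroots, Multiset.countP_map]
    simp only [hk]
    rfl
  change f a ∈ S
  rw [hfa]
  exact ht _

end RootCounting

/-! ### The Hamiltonian matrix and its spectrum at the ends of the deformation. -/

section Hamiltonian

open Polynomial

variable {n m : ℕ}

/-- The Hamiltonian matrix of the control problem with skew-Hermitian `A` and unit weights. -/
def hamiltonian (A : Matrix (Fin n) (Fin n) ℂ) (B : Matrix (Fin n) (Fin m) ℂ) :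
    Matrix (Fin n ⊕ Fin n) (Fin n ⊕ Fin n) ℂ :=
  Matrix.fromBlocks A (-(B * Bᴴ)) (-1) A

lemma closedLoop_one (A : Matrix (Fin n) (Fin n) ℂ) (B : Matrix (Fin n) (Fin m) ℂ)
    (X : Matrix (Fin n) (Fin n) ℂ) : closedLoop A B 1 X = A - B * Bᴴ * X := by
  simp [closedLoop, feedback, Matrix.mul_assoc]

lemma IsRiccatiSolution.mul_closedLoop {A : Matrix (Fin n) (Fin n) ℂ}
    {B : Matrix (Fin n) (Fin m) ℂ} {X : Matrix (Fin n) (Fin n) ℂ} (hA : Aᴴ = -A)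
    (hX : IsRiccatiSolution A B 1 1 X) : X * closedLoop A B 1 X = A * X - 1 := by
  have h := hX.2
  rw [hA, inv_one, Matrix.mul_one] at h
  rw [closedLoop_one, Matrix.mul_sub]
  simp only [← Matrix.mul_assoc]
  rw [Matrix.neg_mul, sub_neg_eq_add] at h
  have h1 : X * A - X * B * Bᴴ * X = A * X - 1 -
      (X * B * Bᴴ * X - X * A + A * X - 1) := by abel
  rw [h1, h, sub_zero]

/-- The Riccati equation says that the graph of X is invariant under the Hamiltonian, so the shear
`P` makes it block triangular. -/
lemma charpoly_hamiltonian {A : Matrix (Fin n) (Fin n) ℂ}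
    {B : Matrix (Fin n) (Fin m) ℂ} {X : Matrix (Fin n) (Fin n) ℂ} (hA : Aᴴ = -A)
    (hX : IsRiccatiSolution A B 1 1 X) :
    (hamiltonian A B).charpoly =
      (closedLoop A B 1 X).charpoly * (-(closedLoop A B 1 X)ᴴ).charpoly := by
  have h1 := hX.mul_closedLoop hA
  have h2 : (closedLoop A B 1 X)ᴴ = -A - X * B * Bᴴ := by
    rw [closedLoop_one, Matrix.conjTranspose_sub, hA, Matrix.conjTranspose_mul,
      Matrix.conjTranspose_mul, Matrix.conjTranspose_conjTranspose, hX.1.isHermitian.eq,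
      Matrix.mul_assoc]
  let P : (Matrix (Fin n ⊕ Fin n) (Fin n ⊕ Fin n) ℂ)ˣ :=
    ⟨Matrix.fromBlocks 1 0 X 1, Matrix.fromBlocks 1 0 (-X) 1,
      by simp [Matrix.fromBlocks_multiply], by simp [Matrix.fromBlocks_multiply]⟩
  have h3 : hamiltonian A B * P.val = P.val * Matrix.fromBlocks (closedLoop A B 1 X) (-(B * Bᴴ)) 0
      (-(closedLoop A B 1 X)ᴴ) := by
    simp only [hamiltonian, P, Matrix.fromBlocks_multiply]
    rw [h2, h1, closedLoop_one]
    congr 1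
    · simp [sub_eq_add_neg]
    · simp
    · simp [sub_eq_neg_add]
    · simp [Matrix.mul_assoc]
  rw [← Matrix.charpoly_fromBlocks_zero₂₁ (closedLoop A B 1 X) (-(B * Bᴴ)),
    ← Matrix.charpoly_units_conj P (Matrix.fromBlocks _ _ 0 _), ← h3, Matrix.mul_assoc]
  rw [Matrix.mul_nonsing_inv _ ((Matrix.isUnit_iff_isUnit_det _).mp P.isUnit), Matrix.mul_one]

lemma charpoly_hamiltonian_smul_one (a : ℂ) (B : Matrix (Fin n) (Fin m) ℂ) :
    (hamiltonian (a • 1) B).charpoly = (B * Bᴴ).charpoly.comp ((X - C a) ^ 2) := by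
  refine Polynomial.funext fun z => ?_
  rw [Matrix.eval_charpoly, eval_comp, Matrix.eval_charpoly]
  simp only [eval_pow, eval_sub, eval_X, eval_C]
  have hs : ∀ w : ℂ, Matrix.scalar (Fin n) w = w • 1 := fun w => by
    rw [Matrix.scalar_apply, Matrix.smul_one_eq_diagonal]
  have hs2 : Matrix.scalar (Fin n ⊕ Fin n) z = Matrix.fromBlocks (z • 1) 0 0 (z • 1) := by
    rw [Matrix.scalar_apply, ← Matrix.smul_one_eq_diagonal, ← Matrix.fromBlocks_one,
      Matrix.fromBlocks_smul]
    simp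
  -- A unipotent column operation turns the lower right block into 1, so the Schur complement needs
  -- no division by z - a.
  have h1 : (Matrix.scalar (Fin n ⊕ Fin n) z - hamiltonian (a • 1) B) *
      Matrix.fromBlocks 1 ((1 - (z - a)) • 1) 0 1 =
      Matrix.fromBlocks ((z - a) • 1) (((z - a) * (1 - (z - a))) • 1 + B * Bᴴ) 1 1 := by
    rw [hs2, hamiltonian, sub_eq_add_neg, Matrix.fromBlocks_neg, Matrix.fromBlocks_add,
      Matrix.fromBlocks_multiply]
    congr 1
    · simp [sub_eq_add_neg, add_smul]
    · simp only [Matrix.mul_smul, Matrix.mul_one, zero_add, neg_neg, ← sub_eq_add_neg, ← sub_smul,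
        smul_smul]
      rw [mul_comm]
    · simp
    · simp only [Matrix.mul_smul, Matrix.mul_one, zero_add, neg_neg, ← sub_eq_add_neg, ← sub_smul,
        ← add_smul]
      simp
  have h2 := congrArg Matrix.det h1
  rw [Matrix.det_mul, Matrix.det_fromBlocks_zero₂₁, Matrix.det_one, mul_one, mul_one,
    Matrix.det_fromBlocks_one₂₂, Matrix.mul_one] at h2
  rw [h2, hs, ← sub_sub, ← sub_smul]
  ring_nf

open Classical in
-- The roots are a (2N times) and a ± √μ_i; only the a - √μ_i lie left of the line.
lemma countP_roots_mul_X_sub_C_sq (a : ℂ) (γ : ℝ) (hγ : γ ≤ a.re) {κ : Type*} [Fintype κ]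
    (μ : κ → ℝ) (hμ0 : ∀ i, 0 ≤ μ i) (hμ : ∀ i, a.re - γ < √(μ i)) (N : ℕ) :
    (((X ^ N * ∏ i, (X - C (μ i : ℂ))).comp ((X - C a) ^ 2)).roots.countP
      fun z => z.re < γ) = Fintype.card κ := by
  have h1 : (X ^ N * ∏ i, (X - C (μ i : ℂ))).comp ((X - C a) ^ 2) =
      (X - C a) ^ (2 * N) * ((∏ i, (X - C (a - (√(μ i) : ℝ)))) *
        ∏ i, (X - C (a + (√(μ i) : ℝ)))) := by
    rw [mul_comp, X_pow_comp, ← pow_mul, prod_comp, ← Finset.prod_mul_distrib]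
    congr 1
    refine Finset.prod_congr rfl fun i _ => ?_
    have h2 : (μ i : ℂ) = ((√(μ i) : ℝ) : ℂ) ^ 2 := by
      rw [← Complex.ofReal_pow, Real.sq_sqrt (hμ0 i)]
    simp only [sub_comp, X_comp, C_comp, C_sub, C_add]
    rw [h2, C_pow]
    ring
  have hne : ∀ r : κ → ℂ, (∏ i, (X - C (r i))) ≠ 0 := fun r =>
    Finset.prod_ne_zero_iff.mpr fun i _ => X_sub_C_ne_zero _
  have hroots : ∀ r : κ → ℂ, (∏ i, (X - C (r i))).roots = Finset.univ.val.map r := fun r => by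
    rw [Polynomial.roots_prod _ _ (hne r)]
    simp [Polynomial.roots_X_sub_C, Multiset.bind_singleton]
  rw [h1, roots_mul (mul_ne_zero (pow_ne_zero _ (X_sub_C_ne_zero a)) (mul_ne_zero (hne _) (hne _))),
    roots_mul (mul_ne_zero (hne _) (hne _)), Multiset.countP_add, Multiset.countP_add, hroots,
    hroots, roots_pow, roots_X_sub_C, Multiset.countP_map, Multiset.countP_map]
  have h3 : (2 * N) • ({a} : Multiset ℂ) = Multiset.replicate (2 * N) a :=
    Multiset.nsmul_singleton _ _
  have h4 : Multiset.countP (fun z : ℂ => z.re < γ) ((2 * N) • ({a} : Multiset ℂ)) = 0 := by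
    rw [h3, Multiset.countP_eq_zero]
    intro z hz
    rw [Multiset.eq_of_mem_replicate hz]
    exact hγ.not_gt
  have h5 : Multiset.filter (fun i => (a - (√(μ i) : ℝ)).re < γ) Finset.univ.val =
      Finset.univ.val := by
    rw [Multiset.filter_eq_self]
    intro i _
    rw [Complex.sub_re, Complex.ofReal_re]
    linarith [hμ i]
  have h6 : Multiset.filter (fun i => (a + (√(μ i) : ℝ)).re < γ) Finset.univ.val = 0 := by
    rw [Multiset.filter_eq_nil]
    intro i _
    rw [Complex.add_re, Complex.ofReal_re]
    linarith [Real.sqrt_nonneg (μ i)]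
  rw [h4, h5, h6]
  simp

open Classical in
lemma countP_roots_hamiltonian_smul_one (hmn : m ≤ n) (a : ℂ) (B : Matrix (Fin n) (Fin m) ℂ)
    {γ σ : ℝ} (hγ : γ ≤ a.re) (hσ : a.re - γ < σ)
    (hB : ∀ x : EuclideanSpace ℂ (Fin m), σ * ‖x‖ ≤ ‖Matrix.toEuclideanLin B x‖) :
    (hamiltonian (a • 1) B).charpoly.roots.countP (fun z => z.re < γ) = m := by
  have hH : (Bᴴ * B).IsHermitian := Matrix.isHermitian_conjTranspose_mul_self B
  have hpsd : (Bᴴ * B).PosSemidef := Matrix.posSemidef_conjTranspose_mul_self B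
  -- The characteristic polynomial of BBᴴ is X^(n-m) times that of BᴴB, whose m eigenvalues are at
  -- least σ².
  rw [charpoly_hamiltonian_smul_one, Matrix.charpoly_mul_comm_of_le _ _ (by simpa using hmn),
    hH.charpoly_eq]
  refine (countP_roots_mul_X_sub_C_sq a γ hγ hH.eigenvalues hpsd.eigenvalues_nonneg ?_ _).trans
    (Fintype.card_fin m)
  intro i
  refine hσ.trans_le (Real.le_sqrt_of_sq_le ?_)
  have hσ0 : 0 ≤ σ := by linarith
  set x := hH.eigenvectorBasis i with hx
  have hx1 : ‖x‖ = 1 := hH.eigenvectorBasis.orthonormal.1 i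
  have h1 := hB x
  rw [hx1, mul_one] at h1
  refine (pow_le_pow_left₀ hσ0 h1 2).trans_eq ?_
  have h2 : Matrix.toEuclideanLin (Bᴴ) (Matrix.toEuclideanLin B x) =
      ((hH.eigenvalues i : ℝ) : ℂ) • x := by
    have h3 := hH.mulVec_eigenvectorBasis i
    rw [← Matrix.mulVec_mulVec] at h3
    ext j
    have h4 := congrFun h3 j
    simpa using h4
  have h3 : inner ℂ (Matrix.toEuclideanLin B x) (Matrix.toEuclideanLin B x) =
      ((hH.eigenvalues i : ℝ) : ℂ) := by
    rw [← LinearMap.adjoint_inner_right, ← Matrix.toEuclideanLin_conjTranspose_eq_adjoint, h2,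
      inner_smul_right, inner_self_eq_norm_sq_to_K, hx1]
    simp
  rw [inner_self_eq_norm_sq_to_K] at h3
  exact Complex.ofReal_injective (by push_cast; exact h3)

end Hamiltonian

/-! ### The smallest singular value as a lower bound. -/

section SingularValue

open Module

variable {E F : Type*} [NormedAddCommGroup E] [InnerProductSpace ℂ E] [FiniteDimensional ℂ E]
  [NormedAddCommGroup F] [InnerProductSpace ℂ F] [FiniteDimensional ℂ F]

lemma singularValues_mul_norm_le (T : E →ₗ[ℂ] F) {m : ℕ} (hm : finrank ℂ E = m) (x : E) :
    T.singularValues (m - 1) * ‖x‖ ≤ ‖T x‖ := by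
  set hS := T.isSymmetric_adjoint_comp_self
  set e := hS.eigenvectorBasis hm
  have h1 : ((‖T x‖ ^ 2 : ℝ) : ℂ) = ∑ i, ((hS.eigenvalues hm i * ‖inner ℂ (e i) x‖ ^ 2 : ℝ) : ℂ) := by
    calc ((‖T x‖ ^ 2 : ℝ) : ℂ) = inner ℂ (T x) (T x) := by
          rw [inner_self_eq_norm_sq_to_K]; push_cast; rfl
      _ = inner ℂ x ((LinearMap.adjoint T ∘ₗ T) x) := by
          rw [LinearMap.comp_apply, LinearMap.adjoint_inner_right]
      _ = ∑ i, inner ℂ x (e i) * inner ℂ (e i) ((LinearMap.adjoint T ∘ₗ T) x) :=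
          (e.sum_inner_mul_inner _ _).symm
      _ = _ := by
          refine Finset.sum_congr rfl fun i _ => ?_
          rw [← hS (e i) x, hS.apply_eigenvectorBasis hm i, inner_smul_left, ← inner_conj_symm x,
            Complex.ofReal_mul, ← Complex.normSq_eq_norm_sq, Complex.normSq_eq_conj_mul_self]
          simp only [Complex.coe_algebraMap, Complex.conj_ofReal]
          ring
  have h2 : ‖T x‖ ^ 2 = ∑ i, hS.eigenvalues hm i * ‖inner ℂ (e i) x‖ ^ 2 := by
    exact_mod_cast h1
  refine le_of_sq_le_sq ?_ (norm_nonneg _)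
  rw [mul_pow, h2, ← e.sum_sq_norm_inner_right x, Finset.mul_sum]
  refine Finset.sum_le_sum fun i _ => mul_le_mul_of_nonneg_right ?_ (by positivity)
  rw [← T.sq_singularValues_fin hm i]
  exact pow_le_pow_left₀ (T.singularValues_nonneg _)
    (T.singularValues_antitone (Nat.le_sub_one_of_lt i.isLt)) 2

end SingularValue

variable {n m : ℕ}

lemma sigmaMin_mul_norm_le (B : Matrix (Fin n) (Fin m) ℂ) (x : EuclideanSpace ℂ (Fin m)) :
    sigmaMin B * ‖x‖ ≤ ‖Matrix.toEuclideanLin B x‖ :=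
  singularValues_mul_norm_le _ (by simp) x

lemma mem_spectrum_iff_exists_mulVec {ι : Type*} [Fintype ι] [DecidableEq ι] {M : Matrix ι ι ℂ}
    {z : ℂ} : z ∈ spectrum ℂ M ↔ ∃ w, w ≠ 0 ∧ M *ᵥ w = z • w := by
  rw [Matrix.mem_spectrum_iff_isRoot_charpoly, Polynomial.IsRoot.def, Matrix.eval_charpoly,
    ← Matrix.exists_mulVec_eq_zero_iff]
  refine exists_congr fun w => and_congr_right fun _ => ?_
  rw [Matrix.sub_mulVec, sub_eq_zero, Matrix.scalar_apply, ← Matrix.smul_one_eq_diagonal,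
    Matrix.smul_mulVec, Matrix.one_mulVec, eq_comm]

/-! ### From eigenvectors to modal solutions. -/

section Modes

variable (v : OrthonormalBasis (Fin n) ℂ (EuclideanSpace ℂ (Fin n)))

lemma inner_bVec (B : Matrix (Fin n) (Fin m) ℂ) (j : Fin n) (w : EuclideanSpace ℂ (Fin m)) :
    inner ℂ (bVec B v j) w = inner ℂ (v j) (Matrix.toEuclideanLin B w) := by
  rw [bVec, Matrix.toEuclideanLin_conjTranspose_eq_adjoint, LinearMap.adjoint_inner_left]

lemma sum_norm_inner_bVec_sq (B : Matrix (Fin n) (Fin m) ℂ) (w : EuclideanSpace ℂ (Fin m)) :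
    ∑ j, ‖inner ℂ (bVec B v j) w‖ ^ 2 = ‖Matrix.toEuclideanLin B w‖ ^ 2 := by
  simp only [inner_bVec]
  exact v.sum_sq_norm_inner_right _

lemma sum_norm_inner_bVec_sq_le (B : Matrix (Fin n) (Fin m) ℂ) (w : EuclideanSpace ℂ (Fin m)) :
    ∑ j, ‖inner ℂ (bVec B v j) w‖ ^ 2 ≤ ‖B‖ ^ 2 * ‖w‖ ^ 2 := by
  rw [sum_norm_inner_bVec_sq, ← mul_pow]
  exact pow_le_pow_left₀ (norm_nonneg _) (B.l2_opNorm_mulVec w) 2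

variable {v} {A : Matrix (Fin n) (Fin n) ℂ} {B : Matrix (Fin n) (Fin m) ℂ} {lam : Fin n → ℝ}
  (hv : ∀ j, Matrix.toEuclideanLin A (v j) = (Complex.I * (lam j : ℂ)) • v j)

include hv

lemma inner_apply_of_eigenbasis (j : Fin n) (z : EuclideanSpace ℂ (Fin n)) :
    inner ℂ (v j) (Matrix.toEuclideanLin A z) = Complex.I * lam j * inner ℂ (v j) z := by
  conv_lhs => rw [← v.sum_repr' z]
  rw [map_sum, inner_sum]
  simp only [map_smul, hv, inner_smul_right]
  rw [Finset.sum_eq_single j]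
  · rw [inner_self_eq_norm_sq_to_K, v.orthonormal.1 j]; simp; ring
  · intro i _ hij
    rw [v.orthonormal.2 hij.symm]; simp
  · simp

lemma modalSolution_of_eigenvector {x y : EuclideanSpace ℂ (Fin n)} {ν : ℂ} (hν : ν.re < 0)
    (hy : y ≠ 0)
    (h1 : Matrix.toEuclideanLin A x - Matrix.toEuclideanLin B (Matrix.toEuclideanLin Bᴴ y) = ν • x)
    (h2 : Matrix.toEuclideanLin A y - x = ν • y) :
    ModalSolution (bVec B v) (-ν.re) (fun j => lam j - ν.im) (fun j => inner ℂ (v j) y)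
      (Matrix.toEuclideanLin Bᴴ y) where
  pos := by linarith
  ne_zero := by
    intro h
    apply hy
    rw [← v.sum_repr' y]
    exact Finset.sum_eq_zero fun j _ => by rw [congrFun h j]; simp
  sum_eq := by
    conv_lhs => rw [← v.sum_repr' y]
    simp [map_sum, bVec]
  inner_eq := by
    intro j
    have hx : x = Matrix.toEuclideanLin A y - ν • y := by rw [← h2]; abel
    have hB : Matrix.toEuclideanLin B (Matrix.toEuclideanLin Bᴴ y) =
        Matrix.toEuclideanLin A x - ν • x := by rw [← h1]; abel
    have hs : ((-ν.re : ℝ) : ℂ) + Complex.I * ((lam j - ν.im : ℝ) : ℂ) =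
        Complex.I * lam j - ν := by
      conv_rhs => rw [← Complex.re_add_im ν]
      push_cast; ring
    rw [inner_bVec, hB, inner_sub_right, inner_smul_right, inner_apply_of_eigenbasis hv, hx,
      inner_sub_right, inner_smul_right, inner_apply_of_eigenbasis hv, hs]
    ring

lemma exists_modalSolution_of_mem_spectrum_hamiltonian {ν : ℂ}
    (h : ν ∈ spectrum ℂ (hamiltonian A B)) (hν : ν.re < 0) :
    ∃ c u, ModalSolution (bVec B v) (-ν.re) (fun j => lam j - ν.im) c u := by
  obtain ⟨w, hw, he⟩ := mem_spectrum_iff_exists_mulVec.mp h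
  obtain ⟨x, y, rfl⟩ : ∃ x y, w = Sum.elim x y := ⟨_, _, (Sum.elim_comp_inl_inr w).symm⟩
  rw [hamiltonian, Matrix.fromBlocks_mulVec] at he
  have h1 : A *ᵥ x - B *ᵥ (Bᴴ *ᵥ y) = ν • x := by
    funext i
    have := congrFun he (Sum.inl i)
    simpa [sub_eq_add_neg, Matrix.neg_mulVec] using this
  have h2 : A *ᵥ y - x = ν • y := by
    funext i
    have := congrFun he (Sum.inr i)
    simpa [sub_eq_neg_add, Matrix.neg_mulVec] using this
  have hy : y ≠ 0 := by
    intro hy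
    rw [hy] at h2
    have hx : x = 0 := by simpa using h2
    rw [hx, hy] at hw
    exact hw (by funext i; cases i <;> rfl)
  refine ⟨_, _, modalSolution_of_eigenvector hv (x := WithLp.toLp 2 x) (y := WithLp.toLp 2 y) hν
    (fun h => hy (congrArg WithLp.ofLp h)) ?_ ?_⟩
  · ext i; simpa using congrFun h1 i
  · ext i; simpa using congrFun h2 i

variable {X : Matrix (Fin n) (Fin n) ℂ} (hA : Aᴴ = -A) (hX : IsRiccatiSolution A B 1 1 X)

include hA hX

lemma closedLoop_modes {ν : ℂ} (h : ν ∈ spectrum ℂ (closedLoop A B 1 X)) :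
    ν.re < 0 ∧ ∃ c u, ModalSolution (bVec B v) (-ν.re) (fun j => lam j - ν.im) c u := by
  obtain ⟨w, hw, he⟩ := mem_spectrum_iff_exists_mulVec.mp h
  set y := X *ᵥ w with hy
  have h1 : A *ᵥ w - B *ᵥ (Bᴴ *ᵥ y) = ν • w := by
    rw [← he, closedLoop_one, Matrix.sub_mulVec, hy, Matrix.mulVec_mulVec, Matrix.mulVec_mulVec,
      Matrix.mul_assoc]
  have h2 : A *ᵥ y - w = ν • y := by
    rw [hy, ← Matrix.mulVec_smul, ← he, Matrix.mulVec_mulVec, Matrix.mulVec_mulVec,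
      hX.mul_closedLoop hA, Matrix.sub_mulVec, Matrix.one_mulVec]
  have hy0 : y ≠ 0 := by
    intro h0
    rw [h0] at h2
    exact hw (by simpa using h2)
  have h1' : Matrix.toEuclideanLin A (WithLp.toLp 2 w) -
      Matrix.toEuclideanLin B (Matrix.toEuclideanLin Bᴴ (WithLp.toLp 2 y)) =
      ν • WithLp.toLp 2 w := by
    ext i; simpa using congrFun h1 i
  have h2' : Matrix.toEuclideanLin A (WithLp.toLp 2 y) - WithLp.toLp 2 w =
      ν • WithLp.toLp 2 y := by
    ext i; simpa using congrFun h2 i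
  have hy' : WithLp.toLp 2 y ≠ (0 : EuclideanSpace ℂ (Fin n)) :=
    fun h => hy0 (congrArg WithLp.ofLp h)
  -- This is ⟨Xw, w⟩, positive because X is semidefinite and Xw ≠ 0.
  have hq : 0 < (inner ℂ (WithLp.toLp 2 y : EuclideanSpace ℂ (Fin n)) (WithLp.toLp 2 w)).re := by
    rw [← inner_conj_symm, Complex.conj_re, EuclideanSpace.inner_eq_star_dotProduct,
      dotProduct_comm]
    have h3 : 0 ≤ star w ⬝ᵥ y := hX.1.dotProduct_mulVec_nonneg w
    have h4 : star w ⬝ᵥ y ≠ 0 := fun h0 => hy0 ((hX.1.dotProduct_mulVec_zero_iff w).mp h0)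
    exact (Complex.pos_iff.mp (h3.lt_of_ne h4.symm)).1
  -- Since w = (A - ν)y and A contributes only an imaginary part, Re⟨y, w⟩ = -Re ν ‖y‖².
  have hν : ν.re < 0 := by
    have h3 : inner ℂ (WithLp.toLp 2 y : EuclideanSpace ℂ (Fin n)) (WithLp.toLp 2 w) =
        ∑ j, (Complex.I * lam j - ν) * ((‖inner ℂ (v j) (WithLp.toLp 2 y)‖ ^ 2 : ℝ) : ℂ) := by
      rw [← v.sum_inner_mul_inner]
      refine Finset.sum_congr rfl fun j _ => ?_
      have h4 : (WithLp.toLp 2 w : EuclideanSpace ℂ (Fin n)) =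
          Matrix.toEuclideanLin A (WithLp.toLp 2 y) - ν • WithLp.toLp 2 y := by
        rw [← h2']; abel
      rw [h4, inner_sub_right, inner_smul_right, inner_apply_of_eigenbasis hv,
        ← Complex.normSq_eq_norm_sq, Complex.normSq_eq_conj_mul_self, inner_conj_symm]
      ring
    rw [h3, Complex.re_sum] at hq
    have h5 : ∀ j, ((Complex.I * lam j - ν) *
        ((‖inner ℂ (v j) (WithLp.toLp 2 y)‖ ^ 2 : ℝ) : ℂ)).re =
        -ν.re * ‖inner ℂ (v j) (WithLp.toLp 2 y)‖ ^ 2 := by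
      intro j
      rw [Complex.re_mul_ofReal]
      simp
    simp only [h5, ← Finset.mul_sum] at hq
    have h6 : 0 ≤ ∑ j, ‖inner ℂ (v j) (WithLp.toLp 2 y)‖ ^ 2 :=
      Finset.sum_nonneg fun _ _ => by positivity
    linarith [pos_of_mul_pos_left hq h6]
  exact ⟨hν, _, _, modalSolution_of_eigenvector hv hν hy' h1' h2'⟩

/-- If Bᴴv_k = 0, then v_k is an eigenvector of A_clᴴ for -iλ_k, which puts iλ_k into the
closed-loop spectrum and contradicts stability. -/
lemma bVec_ne_zero (k : Fin n) : bVec B v k ≠ 0 := by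
  intro h0
  have h1 : (closedLoop A B 1 X)ᴴ = -A - X * B * Bᴴ := by
    rw [closedLoop_one, Matrix.conjTranspose_sub, hA, Matrix.conjTranspose_mul,
      Matrix.conjTranspose_mul, Matrix.conjTranspose_conjTranspose, hX.1.isHermitian.eq,
      Matrix.mul_assoc]
  have hb : Bᴴ *ᵥ (v k).ofLp = 0 := congrArg WithLp.ofLp h0
  have ha : A *ᵥ (v k).ofLp = (Complex.I * lam k) • (v k).ofLp := congrArg WithLp.ofLp (hv k)
  have h2 : -(Complex.I * lam k) ∈ spectrum ℂ (star (closedLoop A B 1 X)) := by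
    refine mem_spectrum_iff_exists_mulVec.mpr ⟨(v k).ofLp, fun h => ?_, ?_⟩
    · exact v.orthonormal.ne_zero k (by ext i; exact congrFun h i)
    · rw [Matrix.star_eq_conjTranspose, h1, Matrix.sub_mulVec, Matrix.neg_mulVec, ha,
        ← Matrix.mulVec_mulVec, hb, Matrix.mulVec_zero, sub_zero, neg_smul]
  rw [spectrum.map_star, Set.mem_star] at h2
  have h3 := (closedLoop_modes hv hA hX h2).1
  simp at h3

end Modes

/-! ### The lower bounds `ellEst` and `ellEstOne`. -/

section Estimates

variable (lam : Fin n → ℝ)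

lemma sep_nonneg (k : Fin n) : 0 ≤ sep lam k :=
  Real.iInf_nonneg fun _ => abs_nonneg _

variable {lam}

lemma sep_pos_and_le (hinj : Function.Injective lam) {j k : Fin n} (hjk : j ≠ k) :
    0 < sep lam k ∧ sep lam k ≤ |lam j - lam k| := by
  have : Nonempty {j : Fin n // j ≠ k} := ⟨⟨j, hjk⟩⟩
  constructor
  · obtain ⟨i, hi⟩ := exists_eq_ciInf_of_finite (f := fun j : {j : Fin n // j ≠ k} =>
      |lam j - lam k|)
    rw [sep, ← hi]
    exact abs_pos.mpr (sub_ne_zero.mpr (hinj.ne i.2))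
  · exact ciInf_le (Set.finite_range _).bddBelow (⟨j, hjk⟩ : {j : Fin n // j ≠ k})

lemma abs_sub_le_diam (p q : Fin n) : |lam p - lam q| ≤ diam lam :=
  le_ciSup (f := fun p : Fin n × Fin n => |lam p.1 - lam p.2|) (Set.finite_range _).bddAbove (p, q)

variable {B : Matrix (Fin n) (Fin m) ℂ}
  {v : OrthonormalBasis (Fin n) ℂ (EuclideanSpace ℂ (Fin n))}

lemma ellEst_lt {s ω : ℝ} {c : Fin n → ℂ} {u : EuclideanSpace ℂ (Fin m)}
    (h : ModalSolution (bVec B v) s (fun j => lam j - ω) c u) : ellEst B lam v < s := by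
  rw [ellEst]
  split_ifs with hinj
  · obtain ⟨k, hk⟩ := h.exists_abs_lt
    refine (ciInf_le (Set.finite_range _).bddBelow k).trans_lt ?_
    rw [div_lt_iff₀ (by positivity), mul_comm s]
    refine h.norm_lt (norm_nonneg B) (sum_norm_inner_bVec_sq_le v B) hk (sep_nonneg lam k) ?_
    intro j hj
    rw [sub_sub_sub_cancel_right]
    exact sep_pos_and_le hinj hj
  · exact h.pos

lemma norm_inner_eq_of_fin_one (x y : EuclideanSpace ℂ (Fin 1)) :
    ‖inner ℂ x y‖ = ‖x‖ * ‖y‖ := by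
  simp [EuclideanSpace.norm_eq, PiLp.inner_apply, mul_comm]

lemma ellEstOne_lt (hm : m = 1) {s ω : ℝ} {c : Fin n → ℂ} {u : EuclideanSpace ℂ (Fin m)}
    (h : ModalSolution (bVec B v) s (fun j => lam j - ω) c u) : ellEstOne B lam v < s := by
  subst hm
  rw [ellEstOne]
  split_ifs with hinj
  · obtain ⟨k, hk⟩ := h.exists_abs_lt
    refine (ciInf_le (Set.finite_range _).bddBelow k).trans_lt ?_
    rw [div_lt_iff₀ (by positivity), mul_comm s]
    refine h.norm_lt_of_norm_inner_eq (norm_nonneg B) (sum_norm_inner_bVec_sq_le v B) hk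
      (sep_nonneg lam k) ?_ (norm_inner_eq_of_fin_one _ _)
    intro j hj
    rw [sub_sub_sub_cancel_right]
    exact sep_pos_and_le hinj hj
  · exact h.pos

variable (B lam v)

lemma ellEst_le_ellEstOne : ellEst B lam v ≤ ellEstOne B lam v := by
  rw [ellEst, ellEstOne]
  split_ifs with hinj
  · refine ciInf_mono (Set.finite_range _).bddBelow fun k => ?_
    have h1 : (1 : ℝ) ≤ 1 + 2 * (‖B‖ ^ 2 / sep lam k ^ 2) := by
      have : 0 ≤ ‖B‖ ^ 2 / sep lam k ^ 2 := by positivity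
      linarith
    have h2 : √(1 + 2 * (‖B‖ ^ 2 / sep lam k ^ 2)) ≤ 1 + 2 * (‖B‖ ^ 2 / sep lam k ^ 2) :=
      Real.sqrt_le_iff.mpr ⟨by positivity, le_self_pow₀ h1 two_ne_zero⟩
    gcongr
  · exact le_rfl

variable {B lam v}

lemma ellEst_lt_ellEstOne (hn : 2 ≤ n) (hinj : Function.Injective lam)
    (hb : ∀ k, bVec B v k ≠ 0) : ellEst B lam v < ellEstOne B lam v := by
  rw [ellEst, ellEstOne, if_pos hinj, if_pos hinj]
  have : Nonempty (Fin n) := ⟨⟨0, by omega⟩⟩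
  have : Nontrivial (Fin n) := Fin.nontrivial_iff_two_le.mpr hn
  -- Strictness is needed only at a minimizer of the larger bound.
  obtain ⟨k, hk⟩ := exists_eq_ciInf_of_finite
    (f := fun k : Fin n => ‖bVec B v k‖ / (√2 * √(1 + 2 * (‖B‖ ^ 2 / sep lam k ^ 2))))
  rw [← hk]
  refine (ciInf_le (Set.finite_range _).bddBelow k).trans_lt ?_
  obtain ⟨j, hj⟩ := exists_ne k
  have hsep := (sep_pos_and_le hinj hj).1
  have hbk := norm_pos_iff.mpr (hb k)
  have hB : 0 < ‖B‖ :=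
    hbk.trans_le (norm_le_of_bessel (norm_nonneg B) (sum_norm_inner_bVec_sq_le v B) k)
  have h1 : (1 : ℝ) < 1 + 2 * (‖B‖ ^ 2 / sep lam k ^ 2) := by
    have : 0 < ‖B‖ ^ 2 / sep lam k ^ 2 := by positivity
    linarith
  have h2 : √(1 + 2 * (‖B‖ ^ 2 / sep lam k ^ 2)) < 1 + 2 * (‖B‖ ^ 2 / sep lam k ^ 2) :=
    (Real.sqrt_lt' (by positivity)).mpr (lt_self_pow₀ h1 one_lt_two)
  exact div_lt_div_of_pos_left hbk (by positivity) (mul_lt_mul_of_pos_left h2 (by positivity))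

end Estimates

/-! ### Location and count of the closed-loop eigenvalues. -/

section Location

variable {A : Matrix (Fin n) (Fin n) ℂ} {B : Matrix (Fin n) (Fin m) ℂ} {lam : Fin n → ℝ}
  {v : OrthonormalBasis (Fin n) ℂ (EuclideanSpace ℂ (Fin n))} {X : Matrix (Fin n) (Fin n) ℂ}

/-- No mode decays at a rate between `√3 Δ` and `√6 / 4 σ`. -/
lemma ModalSolution.sigmaMin_le {μ : Fin n → ℝ} {s ω : ℝ} {c : Fin n → ℂ}
    {u : EuclideanSpace ℂ (Fin m)} (h : ModalSolution (bVec B v) s (fun j => μ j - ω) c u)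
    {i k : Fin n} (hμ : ∀ j, μ j ∈ Set.Icc (lam i) (lam k)) (hs : √3 * diam lam ≤ s) :
    √6 / 4 * sigmaMin B ≤ s := by
  refine h.gap (D := diam lam) ?_ (fun j => ?_) hs
  · rw [sum_norm_inner_bVec_sq, ← mul_pow]
    exact pow_le_pow_left₀ (mul_nonneg (LinearMap.singularValues_nonneg _ _) (norm_nonneg _))
      (sigmaMin_mul_norm_le B u) 2
  -- Both ω and μ_j lie in [λ_i, λ_k], whose length is at most Δ.
  · have h1 := h.mean_mem_Icc hμ
    have h2 := (le_abs_self _).trans (abs_sub_le_diam (lam := lam) k i)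
    have h3 := hμ j
    exact abs_le.mpr ⟨by linarith [h1.2, h3.1], by linarith [h1.1, h3.2]⟩

open Classical in
-- The eigenvalues of A are contracted linearly to iλ_i. They stay in the original interval, so the
-- line Re z = -γ remains in the gap throughout.
lemma countP_roots_hamiltonian
    (hv : ∀ j, Matrix.toEuclideanLin A (v j) = (Complex.I * (lam j : ℂ)) • v j)
    {i k : Fin n} (hlam : ∀ j, lam j ∈ Set.Icc (lam i) (lam k)) (hmn : m ≤ n) {γ : ℝ}
    (hγ0 : 0 < γ) (hγ : √3 * diam lam ≤ γ) (hγσ : γ < √6 / 4 * sigmaMin B) :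
    (hamiltonian A B).charpoly.roots.countP (fun z => z.re < -γ) = m := by
  set a : ℂ := Complex.I * lam i with ha
  have hare : a.re = 0 := by simp [ha]
  set M : unitInterval → Matrix (Fin n ⊕ Fin n) (Fin n ⊕ Fin n) ℂ := fun t =>
    hamiltonian (a • 1 + ((t : ℝ) : ℂ) • (A - a • 1)) B with hM
  have hcont : Continuous M := by
    refine Continuous.matrix_fromBlocks ?_ continuous_const continuous_const ?_ <;> fun_prop
  have hline : ∀ t, ∀ z ∈ spectrum ℂ (M t), z.re ≠ -γ := by
    intro t z hz hre
    set μ : Fin n → ℝ := fun j => lam i + t * (lam j - lam i) with hμ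
    have hvt : ∀ j, Matrix.toEuclideanLin (a • 1 + ((t : ℝ) : ℂ) • (A - a • 1)) (v j) =
        (Complex.I * (μ j : ℂ)) • v j := by
      intro j
      have h1 : Matrix.toEuclideanLin (1 : Matrix (Fin n) (Fin n) ℂ) (v j) = v j := by
        ext; simp
      simp only [map_add, map_smul, map_sub, LinearMap.add_apply, LinearMap.smul_apply,
        LinearMap.sub_apply, hv, h1, ← sub_smul, smul_smul, ← add_smul]
      congr 1
      simp only [hμ, ha]
      push_cast
      ring
    obtain ⟨c, u, h⟩ := exists_modalSolution_of_mem_spectrum_hamiltonian hvt hz (by linarith)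
    have h1 := h.sigmaMin_le (lam := lam) (i := i) (k := k) (fun j => ?_) (by linarith)
    · linarith
    · have h2 := hlam j
      have h3 := mul_nonneg t.2.1 (sub_nonneg.mpr h2.1)
      have h4 := mul_le_of_le_one_left (sub_nonneg.mpr h2.1) t.2.2
      exact ⟨by simp only [hμ]; linarith, by simp only [hμ]; linarith [h2.2]⟩
  have h1 := countP_roots_charpoly_eq_of_path M hcont (-γ) hline 0 1
  have h2 : M 1 = hamiltonian A B := by simp [hM]
  have h3 : M 0 = hamiltonian (a • 1) B := by simp [hM]
  rw [h2, h3] at h1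
  rw [← h1]
  refine countP_roots_hamiltonian_smul_one hmn a B (σ := sigmaMin B) (by linarith) ?_
    (sigmaMin_mul_norm_le B)
  have h6 : √6 / 4 ≤ 1 := by
    rw [div_le_one (by norm_num), Real.sqrt_le_iff]; norm_num
  have hσ : 0 ≤ sigmaMin B := LinearMap.singularValues_nonneg _ _
  have := mul_le_of_le_one_left hσ h6
  rw [hare]
  linarith

variable (hA : Aᴴ = -A) (hX : IsRiccatiSolution A B 1 1 X)
  (hv : ∀ j, Matrix.toEuclideanLin A (v j) = (Complex.I * (lam j : ℂ)) • v j)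
include hA hX hv

open Classical in
-- The other factor, from -A_clᴴ, has all its roots in the right half-plane.
lemma countP_roots_closedLoop {γ : ℝ} (hγ : 0 < γ) :
    (closedLoop A B 1 X).charpoly.roots.countP (fun z => z.re < -γ) =
      (hamiltonian A B).charpoly.roots.countP (fun z => z.re < -γ) := by
  rw [charpoly_hamiltonian hA hX, Polynomial.roots_mul (mul_ne_zero
    (Matrix.charpoly_monic _).ne_zero (Matrix.charpoly_monic _).ne_zero), Multiset.countP_add,
    left_eq_add, Multiset.countP_eq_zero]
  intro z hz
  rw [← mem_spectrum_iff_mem_roots_charpoly, ← spectrum.neg_eq, Set.mem_neg,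
    ← Matrix.star_eq_conjTranspose, spectrum.map_star, Set.mem_star] at hz
  have h := (closedLoop_modes hv hA hX hz).1
  simp at h
  linarith

lemma mem_strip_of_mem_spectrum {i k : Fin n} (hlam : ∀ j, lam j ∈ Set.Icc (lam i) (lam k))
    {ν : ℂ} (hν : ν ∈ spectrum ℂ (closedLoop A B 1 X)) :
    -‖B‖ ≤ ν.re ∧ ν.im ∈ Set.Icc (lam i) (lam k) := by
  obtain ⟨-, c, u, h⟩ := closedLoop_modes hv hA hX hν
  have := h.le_bound (norm_nonneg B) (sum_norm_inner_bVec_sq_le v B)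
  exact ⟨by linarith, h.mean_mem_Icc hlam⟩

/-- Splitting of the closed-loop spectrum into a fast and a slow part, with any lower bound `ℓ` for
the decay rates. -/
theorem eigCount_closedLoop {i k : Fin n} (hlam : ∀ j, lam j ∈ Set.Icc (lam i) (lam k)) {ℓ : ℝ}
    (hℓ : ∀ ν ∈ spectrum ℂ (closedLoop A B 1 X),
      ν ∈ Set.Ico (-‖B‖) (-ℓ) ×ℂ Set.Icc (lam i) (lam k))
    (hmn : m ≤ n) (hσ : 2 * √2 * diam lam < sigmaMin B) :
    eigCount (closedLoop A B 1 X)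
        (Set.Icc (-‖B‖) (-(√6 / 4 * sigmaMin B)) ×ℂ Set.Icc (lam i) (lam k)) = m ∧
      eigCount (closedLoop A B 1 X)
        (Set.Ioo (-(√3 * diam lam)) (-ℓ) ×ℂ Set.Icc (lam i) (lam k)) = n - m ∧
      ∀ ν ∈ spectrum ℂ (closedLoop A B 1 X),
        ν ∉ Set.Icc (-‖B‖) (-(√6 / 4 * sigmaMin B)) ×ℂ Set.Icc (lam i) (lam k) →
        ν ∈ Set.Ioo (-(√3 * diam lam)) (-ℓ) ×ℂ Set.Icc (lam i) (lam k) := by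
  classical
  have hΔ : 0 ≤ diam lam := (abs_nonneg _).trans (abs_sub_le_diam i i)
  have hgap : √3 * diam lam < √6 / 4 * sigmaMin B := by
    -- The constant 2√2 in the hypothesis is the one for which the gap is nonempty.
    have h1 : √6 / 4 * (2 * √2) = √3 := by
      have h2 : √6 = √3 * √2 := by rw [← Real.sqrt_mul (by norm_num)]; norm_num
      have h3 : √2 * √2 = 2 := Real.mul_self_sqrt (by norm_num)
      rw [h2]
      linear_combination (√3 / 2) * h3
    rw [← h1, mul_assoc]
    exact mul_lt_mul_of_pos_left hσ (by positivity)
  obtain ⟨γ, hγ1, hγ2⟩ := exists_between hgap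
  have hγ0 : 0 < γ := lt_of_le_of_lt (by positivity) hγ1
  have hdich : ∀ ν ∈ spectrum ℂ (closedLoop A B 1 X),
      √3 * diam lam ≤ -ν.re → √6 / 4 * sigmaMin B ≤ -ν.re := by
    intro ν hν hs
    obtain ⟨-, c, u, h⟩ := closedLoop_modes hv hA hX hν
    exact h.sigmaMin_le hlam hs
  -- By the gap, the side of Re z = -γ alone decides which box contains an eigenvalue.
  have hfast : ∀ ν ∈ spectrum ℂ (closedLoop A B 1 X),
      (ν ∈ Set.Icc (-‖B‖) (-(√6 / 4 * sigmaMin B)) ×ℂ Set.Icc (lam i) (lam k) ↔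
        ν.re < -γ) := by
    intro ν hν
    have h1 := hℓ ν hν
    rw [Complex.mem_reProdIm] at h1 ⊢
    constructor
    · intro h; linarith [h.1.2]
    · intro h
      exact ⟨⟨h1.1.1, by linarith [hdich ν hν (by linarith)]⟩, h1.2⟩
  have hslow : ∀ ν ∈ spectrum ℂ (closedLoop A B 1 X),
      (ν ∈ Set.Ioo (-(√3 * diam lam)) (-ℓ) ×ℂ Set.Icc (lam i) (lam k) ↔ ¬ ν.re < -γ) := by
    intro ν hν
    have h1 := hℓ ν hν
    rw [Complex.mem_reProdIm] at h1 ⊢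
    constructor
    · intro h; linarith [h.1.1]
    · intro h
      refine ⟨⟨?_, h1.1.2⟩, h1.2⟩
      by_contra! h2
      linarith [hdich ν hν (by linarith)]
  have hcount := (countP_roots_closedLoop hA hX hv hγ0).trans
    (countP_roots_hamiltonian hv hlam hmn hγ0 hγ1.le hγ2)
  have hcard : (closedLoop A B 1 X).charpoly.roots.card = n := by
    rw [IsAlgClosed.card_roots_eq_natDegree, Matrix.charpoly_natDegree_eq_dim, Fintype.card_fin]
  refine ⟨?_, ?_, fun ν hν h => (hslow ν hν).mpr (mt (hfast ν hν).mpr h)⟩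
  · refine Eq.trans ?_ hcount
    rw [eigCount]
    exact Multiset.countP_congr rfl fun ν hν =>
      propext (hfast ν (mem_spectrum_iff_mem_roots_charpoly.mpr hν))
  · have h1 : eigCount (closedLoop A B 1 X)
        (Set.Ioo (-(√3 * diam lam)) (-ℓ) ×ℂ Set.Icc (lam i) (lam k)) =
        (closedLoop A B 1 X).charpoly.roots.countP (fun z => ¬ z.re < -γ) := by
      rw [eigCount]
      exact Multiset.countP_congr rfl fun ν hν =>
        propext (hslow ν (mem_spectrum_iff_mem_roots_charpoly.mpr hν))
    have h2 := Multiset.card_eq_countP_add_countP (fun z : ℂ => z.re < -γ)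
      (closedLoop A B 1 X).charpoly.roots
    rw [h1]
    omega

end Location

end LQR

theorem theorem1 {n m : ℕ} (hn : 0 < n) (hm : 0 < m)
    (A : Matrix (Fin n) (Fin n) ℂ) (B : Matrix (Fin n) (Fin m) ℂ)
    (hA : Aᴴ = -A)
    -- eigenvalues of `A` in increasing order, with an orthonormal basis of eigenvectors
    (lam : Fin n → ℝ) (hlam : Monotone lam)
    (v : OrthonormalBasis (Fin n) ℂ (EuclideanSpace ℂ (Fin n)))
    (hv : ∀ j, Matrix.toEuclideanLin A (v j) = (Complex.I * (lam j : ℂ)) • v j)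
    (X : Matrix (Fin n) (Fin n) ℂ)
    (hX : LQR.IsRiccatiSolution A B 1 1 X) :
    -- (1)
    (∀ ν ∈ spectrum ℂ (LQR.closedLoop A B 1 X),
      ν ∈ Set.Ico (-‖B‖) (-LQR.ellEst B lam v) ×ℂ
        Set.Icc (lam ⟨0, hn⟩) (lam ⟨n - 1, Nat.sub_one_lt_of_lt hn⟩)) ∧
    -- (2)
    (m ≤ n → 2 * √2 * LQR.diam lam < LQR.sigmaMin B →
      LQR.eigCount (LQR.closedLoop A B 1 X)
        (Set.Icc (-‖B‖) (-(√6 / 4 * LQR.sigmaMin B)) ×ℂ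
          Set.Icc (lam ⟨0, hn⟩) (lam ⟨n - 1, Nat.sub_one_lt_of_lt hn⟩)) = m ∧
      LQR.eigCount (LQR.closedLoop A B 1 X)
        (Set.Ioo (-(√3 * LQR.diam lam)) (-LQR.ellEst B lam v) ×ℂ
          Set.Icc (lam ⟨0, hn⟩) (lam ⟨n - 1, Nat.sub_one_lt_of_lt hn⟩)) = n - m ∧
      ∀ ν ∈ spectrum ℂ (LQR.closedLoop A B 1 X),
        ν ∉ Set.Icc (-‖B‖) (-(√6 / 4 * LQR.sigmaMin B)) ×ℂ
          Set.Icc (lam ⟨0, hn⟩) (lam ⟨n - 1, Nat.sub_one_lt_of_lt hn⟩) →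
        ν ∈ Set.Ioo (-(√3 * LQR.diam lam)) (-LQR.ellEst B lam v) ×ℂ
          Set.Icc (lam ⟨0, hn⟩) (lam ⟨n - 1, Nat.sub_one_lt_of_lt hn⟩)) ∧
    -- (3)
    (m = 1 →
      LQR.ellEst B lam v ≤ LQR.ellEstOne B lam v ∧
      (2 ≤ n → Function.Injective lam → LQR.ellEst B lam v < LQR.ellEstOne B lam v) ∧
      (∀ ν ∈ spectrum ℂ (LQR.closedLoop A B 1 X),
        ν ∈ Set.Ico (-‖B‖) (-LQR.ellEstOne B lam v) ×ℂ
          Set.Icc (lam ⟨0, hn⟩) (lam ⟨n - 1, Nat.sub_one_lt_of_lt hn⟩)) ∧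
      (2 * √2 * LQR.diam lam < LQR.sigmaMin B →
        LQR.eigCount (LQR.closedLoop A B 1 X)
          (Set.Icc (-‖B‖) (-(√6 / 4 * LQR.sigmaMin B)) ×ℂ
            Set.Icc (lam ⟨0, hn⟩) (lam ⟨n - 1, Nat.sub_one_lt_of_lt hn⟩)) = m ∧
        LQR.eigCount (LQR.closedLoop A B 1 X)
          (Set.Ioo (-(√3 * LQR.diam lam)) (-LQR.ellEstOne B lam v) ×ℂ
            Set.Icc (lam ⟨0, hn⟩) (lam ⟨n - 1, Nat.sub_one_lt_of_lt hn⟩)) = n - m ∧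
        ∀ ν ∈ spectrum ℂ (LQR.closedLoop A B 1 X),
          ν ∉ Set.Icc (-‖B‖) (-(√6 / 4 * LQR.sigmaMin B)) ×ℂ
            Set.Icc (lam ⟨0, hn⟩) (lam ⟨n - 1, Nat.sub_one_lt_of_lt hn⟩) →
          ν ∈ Set.Ioo (-(√3 * LQR.diam lam)) (-LQR.ellEstOne B lam v) ×ℂ
            Set.Icc (lam ⟨0, hn⟩) (lam ⟨n - 1, Nat.sub_one_lt_of_lt hn⟩))) := by
  have hlam' : ∀ j, lam j ∈ Set.Icc (lam ⟨0, hn⟩) (lam ⟨n - 1, Nat.sub_one_lt_of_lt hn⟩) :=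
    fun j => ⟨hlam (Fin.mk_le_of_le_val (Nat.zero_le _)),
      hlam (Fin.le_def.mpr (Nat.le_sub_one_of_lt j.isLt))⟩
  have hest : ∀ ν ∈ spectrum ℂ (LQR.closedLoop A B 1 X),
      ν ∈ Set.Ico (-‖B‖) (-LQR.ellEst B lam v) ×ℂ
        Set.Icc (lam ⟨0, hn⟩) (lam ⟨n - 1, Nat.sub_one_lt_of_lt hn⟩) := by
    intro ν hν
    obtain ⟨h1, h2⟩ := LQR.mem_strip_of_mem_spectrum hA hX hv hlam' hν
    obtain ⟨-, c, u, h⟩ := LQR.closedLoop_modes hv hA hX hν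
    exact ⟨⟨h1, lt_neg_of_lt_neg (LQR.ellEst_lt h)⟩, h2⟩
  refine ⟨hest, LQR.eigCount_closedLoop hA hX hv hlam' hest, fun hm1 => ?_⟩
  have hestOne : ∀ ν ∈ spectrum ℂ (LQR.closedLoop A B 1 X),
      ν ∈ Set.Ico (-‖B‖) (-LQR.ellEstOne B lam v) ×ℂ
        Set.Icc (lam ⟨0, hn⟩) (lam ⟨n - 1, Nat.sub_one_lt_of_lt hn⟩) := by
    intro ν hν
    obtain ⟨h1, h2⟩ := LQR.mem_strip_of_mem_spectrum hA hX hv hlam' hν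
    obtain ⟨-, c, u, h⟩ := LQR.closedLoop_modes hv hA hX hν
    exact ⟨⟨h1, lt_neg_of_lt_neg (LQR.ellEstOne_lt hm1 h)⟩, h2⟩
  exact ⟨LQR.ellEst_le_ellEstOne lam B v,
    fun h2 hinj => LQR.ellEst_lt_ellEstOne h2 hinj (LQR.bVec_ne_zero hv hA hX), hestOne,
    LQR.eigCount_closedLoop hA hX hv hlam' hestOne (by omega)⟩
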